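/- Let $\Sigma_2=\{0,1\}^{\mathbb N}$ be the space of one-sided sequences $x=x_1x_2x_3\cdots$ of zeros and ones with the metric $d(x,x)=0$ and $d(x,y)=1/i$, $i=\min\{j\ge 1: x_j\ne y_j\}$, for $x\neq y$, and let $\sigma(x)_n=x_{n+1}$ be the shift. A subshift is a non-empty closed set $X\subset\Sigma_2$ with $\sigma(X)\subset X$, considered as the dynamical system $(X,\sigma|_X)$. For a dynamical system $(X,T)$ (a continuous self-map $T$ of a compact metric space $(X,d)$), a point $x$ is a transitive point if $\bigcap_{N\ge 0}\overline{\{T^nx: n\ge N\}}=X$; the system is transitive if it has a transitive point, and minimal if it is non-empty and all its points are transitive points. A point $x$ is mean equicontinuous if for every $\varepsilon>0$ there is $\delta>0$ such that $$\limsup_{n\to\infty}\frac1n\sum_{i=0}^{n-1}d(T^ix,T^iy)<\varepsilon\quad\text{for all } y\in X \text{ with } d(x,y)<\delta .$$ The system is almost mean equicontinuous if it is transitive and has at least one mean equicontinuous point. Two systems are conjugate if some homeomorphism between them intertwines their maps. There exist many almost mean equicontinuous systems with positive topological entropy, in the following sense. (1) Every minimal subshift $Y\subset\Sigma_2$ of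 positive topological entropy is contained in an almost mean equicontinuous subshift $X\subset\Sigma_2$ of positive topological entropy. (2) There is a family $(X_t)_{t\in\mathbb R}$ of pairwise non-conjugate subshifts of $\Sigma_2$ such that each $X_t$ is almost mean equicontinuous, has positive topological entropy, and contains a minimal subshift of positive topological entropy. -/

import Mathlib

namespace AlmostMeanEquicontinuity

/-! ### Dynamical systems

A dynamical system is a continuous self-map `T` of a compact metric space `X`. The notions below
are stated for a self-map of a metric space; they are used for compact `X` and continuous `T`. -/

section Systems

variable {X : Type*} [MetricSpace X]

/-- `x` is a transitive point of `(X, T)`: its omega-limit set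
`⋂ N, closure {T^n x : n ≥ N}` is all of `X`. -/
def IsTransitivePoint (T : X → X) (x : X) : Prop :=
  omegaLimit Filter.atTop (fun (n : ℕ) (z : X) => T^[n] z) {x} = Set.univ

/-- `(X, T)` is transitive: it has a transitive point. -/
def IsTransitive (T : X → X) : Prop :=
  ∃ x : X, IsTransitivePoint T x

/-- `(X, T)` is minimal: `X` is non-empty and every point is a transitive point. -/
def IsMinimal (T : X → X) : Prop :=
  Nonempty X ∧ ∀ x : X, IsTransitivePoint T x

/-- `x` is a mean equicontinuous point of `(X, T)`: for every `ε > 0` there is `δ > 0` such that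
`limsup (1/n) ∑_{i<n} d(T^i x, T^i y) < ε` for all `y` with `d(x, y) < δ`.
The averages are bounded since `X` is compact, so the real `limsup` is the usual one. -/
def IsMeanEquicontinuousPoint (T : X → X) (x : X) : Prop :=
  ∀ ε : ℝ, 0 < ε → ∃ δ : ℝ, 0 < δ ∧ ∀ y : X, dist x y < δ →
    Filter.limsup
      (fun n : ℕ => (1 / (n : ℝ)) * ∑ i ∈ Finset.range n, dist (T^[i] x) (T^[i] y))
      Filter.atTop < ε

/-- `(X, T)` is almost mean equicontinuous: it is transitive and has at least one mean
equicontinuous point. -/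
def IsAlmostMeanEquicontinuous (T : X → X) : Prop :=
  IsTransitive T ∧ ∃ x : X, IsMeanEquicontinuousPoint T x

/-- The topological entropy of `(X, T)` (Bowen's definition through dynamical covers). -/
noncomputable def topologicalEntropy (T : X → X) : EReal :=
  Dynamics.coverEntropy T Set.univ

end Systems

/-- `(X, T)` and `(Y, S)` are conjugate: there is a homeomorphism intertwining `T` and `S`. -/
def AreConjugate {X Y : Type*} [MetricSpace X] [MetricSpace Y] (T : X → X) (S : Y → Y) : Prop :=
  ∃ φ : X ≃ₜ Y, ∀ x : X, φ (T x) = S (φ x)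

/-! ### The one-sided full shift on two symbols -/

/-- The space `{0,1}^ℕ` of one-sided sequences of zeros and ones. -/
def Sigma2 : Type := ℕ → Fin 2

namespace Sigma2

open Classical in
/-- `d(x, y) = 0` if `x = y`, and otherwise `d(x, y) = 1 / i`, where `i ≥ 1` is the first position
at which `x` and `y` differ, positions being counted from `1`. (`PiNat.firstDiff` is the first
such index when indices are counted from `0`.) -/
noncomputable def distance (x y : ℕ → Fin 2) : ℝ :=
  if x = y then 0 else 1 / ((PiNat.firstDiff x y : ℝ) + 1)

theorem distance_self (x : ℕ → Fin 2) : distance x x = 0 := by simp [distance]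

theorem distance_comm (x y : ℕ → Fin 2) : distance x y = distance y x := by
  by_cases h : x = y
  · rw [h]
  · rw [distance, distance, if_neg h, if_neg (Ne.symm h), PiNat.firstDiff_comm]

theorem distance_nonneg (x y : ℕ → Fin 2) : 0 ≤ distance x y := by
  unfold distance
  split_ifs <;> positivity

theorem eq_of_distance_eq_zero (x y : ℕ → Fin 2) (h : distance x y = 0) : x = y := by
  by_contra hne
  rw [distance, if_neg hne] at h
  have : (0 : ℝ) < 1 / ((PiNat.firstDiff x y : ℝ) + 1) := by positivity
  exact this.ne' h

theorem distance_triangle (x y z : ℕ → Fin 2) : distance x z ≤ distance x y + distance y z := by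
  by_cases hxz : x = z
  · rw [hxz, distance_self]
    exact add_nonneg (distance_nonneg _ _) (distance_nonneg _ _)
  by_cases hxy : x = y
  · rw [hxy, distance_self, zero_add]
  by_cases hyz : y = z
  · rw [hyz, distance_self, add_zero]
  have key := PiNat.min_firstDiff_le x y z hxz
  rcases min_le_iff.1 key with h | h
  · have h1 : distance x z ≤ distance x y := by
      rw [distance, distance, if_neg hxz, if_neg hxy]
      exact one_div_le_one_div_of_le (by positivity) (by exact_mod_cast Nat.succ_le_succ h)
    linarith [distance_nonneg y z]
  · have h1 : distance x z ≤ distance y z := by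
      rw [distance, distance, if_neg hxz, if_neg hyz]
      exact one_div_le_one_div_of_le (by positivity) (by exact_mod_cast Nat.succ_le_succ h)
    linarith [distance_nonneg x y]

/-- The balls of `distance` are cylinders. -/
theorem distance_lt_iff (x y : ℕ → Fin 2) (n : ℕ) :
    distance x y < 1 / ((n : ℝ) + 1) ↔
      y ∈ PiNat.cylinder x (n + 1) := by
  by_cases hxy : x = y
  · subst hxy
    rw [distance_self]
    exact ⟨fun _ => PiNat.self_mem_cylinder _ _, fun _ => by positivity⟩
  · rw [PiNat.mem_cylinder_comm, PiNat.mem_cylinder_iff_le_firstDiff hxy,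
      distance, if_neg hxy, one_div_lt_one_div (by positivity) (by positivity), Nat.succ_le_iff]
    constructor
    · intro h
      have h' : (n : ℝ) < (PiNat.firstDiff x y : ℝ) := by linarith
      exact_mod_cast h'
    · intro h
      have h' : (n : ℝ) < (PiNat.firstDiff x y : ℝ) := by exact_mod_cast h
      linarith

theorem isOpen_iff_distance (s : Set (ℕ → Fin 2)) :
    IsOpen s ↔ ∀ x ∈ s, ∃ ε > 0, ∀ y, distance x y < ε → y ∈ s := by
  constructor
  · intro hs x hx
    obtain ⟨v, ⟨y, n, rfl⟩, hv, hvs⟩ :=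
      (PiNat.isTopologicalBasis_cylinders (fun _ => Fin 2)).exists_subset_of_mem_open hx hs
    rw [← PiNat.mem_cylinder_iff_eq.1 hv] at hvs
    refine ⟨1 / ((n : ℝ) + 1), by positivity, fun z hz => hvs ?_⟩
    exact PiNat.cylinder_anti _ (Nat.le_succ n) ((distance_lt_iff x z n).1 hz)
  · intro h
    refine (PiNat.isTopologicalBasis_cylinders (fun _ => Fin 2)).isOpen_iff.2 fun x hx => ?_
    obtain ⟨ε, hε, hs⟩ := h x hx
    obtain ⟨n, hn⟩ := exists_nat_one_div_lt hε
    exact ⟨PiNat.cylinder x (n + 1), ⟨x, n + 1, rfl⟩,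
      PiNat.self_mem_cylinder _ _,
      fun y hy => hs y (((distance_lt_iff x y n).2 hy).trans hn)⟩

/-- The metric `distance` on `{0,1}^ℕ`. -/
noncomputable instance : MetricSpace Sigma2 :=
  MetricSpace.ofDistTopology (α := ℕ → Fin 2) distance distance_self distance_comm
    distance_triangle isOpen_iff_distance eq_of_distance_eq_zero

/-- The metric induces the product topology of the discrete topologies. -/
theorem topology_eq : (UniformSpace.toTopologicalSpace : TopologicalSpace Sigma2) =
    (Pi.topologicalSpace : TopologicalSpace (ℕ → Fin 2)) := rfl

instance : CompactSpace Sigma2 := inferInstanceAs (CompactSpace (ℕ → Fin 2))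

theorem dist_eq (x y : Sigma2) : dist x y = distance x y := rfl

/-- The shift map `σ(x)_n = x_{n+1}`. -/
def shift (x : Sigma2) : Sigma2 := fun n => x (n + 1)

theorem continuous_shift : Continuous shift :=
  continuous_pi (A := fun _ : ℕ => Fin 2) fun n => continuous_apply (n + 1)

end Sigma2

/-- A subshift of the full shift: a non-empty closed set `X ⊆ {0,1}^ℕ` with `σ(X) ⊆ X`. -/
structure Subshift where
  carrier : Set Sigma2
  nonempty : carrier.Nonempty
  isClosed : IsClosed carrier
  mapsTo : Set.MapsTo Sigma2.shift carrier carrier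

namespace Subshift

/-- The shift map restricted to a subshift, so that `(X.carrier, X.map)` is a dynamical system
(with the restricted metric). -/
def map (X : Subshift) : X.carrier → X.carrier :=
  X.mapsTo.restrict

theorem compactSpace_carrier (X : Subshift) : CompactSpace X.carrier :=
  isCompact_iff_compactSpace.1 X.isClosed.isCompact

theorem continuous_map (X : Subshift) : Continuous X.map :=
  Sigma2.continuous_shift.restrict X.mapsTo

end Subshift

end AlmostMeanEquicontinuity

/-!
The subshift `X` is the orbit closure of a sequence `x` that starts with each of the words
`A 0 = 1`, `A (k + 1) = A k 0 ^ g W k 0 ^ g A k`, where `W k` is a prefix, of length tending to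
infinity with `k`, of a point `y` of the given minimal subshift `Y`, and the gap `g = gap k` is much
longer than `A k` and `W k`. All `A k` recur, so `x` is a transitive point of `X`, and all `W k`
occur, so `Y ⊆ X`, whence the entropy of `X` is positive. The ones of `x` are sparse, although `X`
contains points of `Y`, in which they are not. What makes `x` a mean equicontinuous point is that
ones are sparse also in the points of `X` close to `x`. Indeed, `Y` does not contain `000⋯`, because
it would be a single fixed point without entropy otherwise. So runs of zeros are short in `y`, and a
run of exactly `gap k` zeros occurs in `x` only as one of the two gaps inserted at stage `k`
(`Seed.isRun_word_succ`). After such a run, at most the rest of `A (k + 1)` has to be read before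
all further ones are preceded by proportionally long gaps of stages `> k`, and hence have frequency
at most `2 ^ (-k)` (`Seed.sum_word_le`). A point of `X` close to `x` shows this run near its
beginning, and two sequences with few ones are close on average (`Sigma2.limsup_dist_le`).

For the second part, a minimal subshift of positive entropy is needed: the orbit closure of a
Toeplitz sequence in which at every stage all possible fillings of the holes occur, but only in a
small proportion of the periods, so that at least half of all positions are holes at all times
(`Toeplitz.period_le_two_mul_card_holes`). Moreover the parities of the gaps can be prescribed by
any 0-1-sequence `c`, which is recovered from the set of long runs of zeros
(`Seed.subshift_injective`). This gives continuum many distinct subshifts. A conjugacy between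
subshifts is determined by a clopen set, so each is conjugate to only countably many others
(`Subshift.countable_setOf_areConjugate`), and continuum many conjugacy classes remain.
-/

namespace AlmostMeanEquicontinuity

/-! ### Symbolic dynamics in terms of words -/

namespace Sigma2

theorem iterate_shift_apply (x : Sigma2) (n i : ℕ) : (shift^[n] x) i = x (n + i) := by
  induction n generalizing x with
  | zero => simp
  | succ n ih =>
    rw [Function.iterate_succ_apply, ih]
    change x (n + i + 1) = _
    congr 1
    omega

theorem dist_lt_iff (x y : Sigma2) (n : ℕ) :
    dist x y < 1 / ((n : ℝ) + 1) ↔ ∀ i ≤ n, y i = x i := by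
  refine (distance_lt_iff x y n).trans ?_
  exact ⟨fun h i hi => h i (by omega), fun h i hi => h i (by omega)⟩

theorem dist_le_one (x y : Sigma2) : dist x y ≤ 1 := by
  change distance x y ≤ 1
  unfold distance
  split_ifs
  · exact zero_le_one
  · rw [div_le_one (by positivity)]
    have : (0 : ℝ) ≤ PiNat.firstDiff x y := by positivity
    linarith

theorem mem_closure_iff_words (x : Sigma2) (S : Set Sigma2) :
    x ∈ closure S ↔ ∀ m : ℕ, ∃ s ∈ S, ∀ i < m, s i = x i := by
  rw [Metric.mem_closure_iff]
  constructor
  · intro h m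
    obtain ⟨s, hs, hd⟩ := h (1 / ((m : ℝ) + 1)) (by positivity)
    exact ⟨s, hs, fun i hi => (dist_lt_iff x s m).1 hd i hi.le⟩
  · intro h ε hε
    obtain ⟨n, hn⟩ := exists_nat_one_div_lt hε
    obtain ⟨s, hs, hi⟩ := h (n + 1)
    exact ⟨s, hs, ((dist_lt_iff x s n).2 fun i h => hi i (by omega)).trans hn⟩

/-- The orbit closure of `x`, as a subshift. -/
def orbitClosure (x : Sigma2) : Subshift where
  carrier := closure (Set.range fun n : ℕ => shift^[n] x)
  nonempty := ⟨x, subset_closure ⟨0, rfl⟩⟩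
  isClosed := isClosed_closure
  mapsTo := by
    refine Set.MapsTo.closure ?_ continuous_shift
    rintro _ ⟨n, rfl⟩
    exact ⟨n + 1, Function.iterate_succ_apply' shift n x⟩

theorem mem_orbitClosure (x z : Sigma2) :
    z ∈ (orbitClosure x).carrier ↔ ∀ m : ℕ, ∃ p : ℕ, ∀ i < m, x (p + i) = z i := by
  refine (mem_closure_iff_words z _).trans (forall_congr' fun m => ?_)
  simp [iterate_shift_apply]

theorem self_mem_orbitClosure (x : Sigma2) : x ∈ (orbitClosure x).carrier :=
  subset_closure ⟨0, rfl⟩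

theorem iterate_shift_mem_orbitClosure (x : Sigma2) (n : ℕ) :
    shift^[n] x ∈ (orbitClosure x).carrier :=
  subset_closure ⟨n, rfl⟩

end Sigma2

namespace Subshift

open Sigma2

theorem ext_carrier {X Y : Subshift} (h : X.carrier = Y.carrier) : X = Y := by
  cases X; cases Y; cases h; rfl

theorem coe_iterate_map (X : Subshift) (n : ℕ) (x : X.carrier) :
    ((X.map^[n] x : X.carrier) : Sigma2) = shift^[n] x := by
  induction n with
  | zero => rfl
  | succ n ih =>
    rw [Function.iterate_succ_apply', Function.iterate_succ_apply', ← ih]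
    rfl

/-- A point is transitive iff every word of the subshift occurs in it at arbitrarily late
positions. -/
theorem isTransitivePoint_iff (X : Subshift) (x : X.carrier) :
    IsTransitivePoint X.map x ↔
      ∀ z ∈ X.carrier, ∀ m N : ℕ, ∃ n ≥ N, ∀ i < m, x.1 (n + i) = z i := by
  rw [IsTransitivePoint, Set.eq_univ_iff_forall]
  simp only [mem_omegaLimit_singleton_iff_mapClusterPt,
    Metric.nhds_basis_ball_inv_nat_succ.mapClusterPt_iff_frequently, Filter.frequently_atTop,
    Metric.mem_ball', Subtype.dist_eq, coe_iterate_map, dist_lt_iff, iterate_shift_apply]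
  constructor
  · intro h z hz m N
    obtain ⟨n, hn, hi⟩ := h ⟨z, hz⟩ m trivial N
    exact ⟨n, hn, fun i him => hi i him.le⟩
  · intro h z m _ N
    obtain ⟨n, hn, hi⟩ := h z z.2 (m + 1) N
    exact ⟨n, hn, fun i him => hi i (by omega)⟩

/-- The orbit closure of a uniformly recurrent sequence is minimal. -/
theorem isMinimal_orbitClosure {x : Sigma2}
    (hx : ∀ m : ℕ, ∃ P : ℕ, ∀ n : ℕ, ∃ i < P, ∀ j < m, x (n + i + j) = x j) :
    IsMinimal (orbitClosure x).map := by
  refine ⟨⟨⟨x, self_mem_orbitClosure x⟩⟩, ?_⟩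
  rintro ⟨y, hy⟩
  rw [isTransitivePoint_iff]
  intro z hz m N
  obtain ⟨q, hq⟩ := (mem_orbitClosure x z).1 hz m
  obtain ⟨P, hP⟩ := hx (q + m)
  obtain ⟨p, hp⟩ := (mem_orbitClosure x y).1 hy (N + P + (q + m))
  obtain ⟨i, hi, hj⟩ := hP (p + N)
  refine ⟨N + i + q, by omega, fun l hl => ?_⟩
  rw [← hq l hl, ← hj (q + l) (by omega)]
  change y (N + i + q + l) = _
  rw [← hp (N + i + q + l) (by omega)]
  congr 1
  omega

/-! ### Entropy of subshifts -/

theorem topologicalEntropy_map (X : Subshift) :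
    topologicalEntropy X.map = Dynamics.coverEntropy shift X.carrier :=
  Dynamics.coverEntropy_restrict X.mapsTo

theorem topologicalEntropy_mono {X Y : Subshift} (h : Y.carrier ⊆ X.carrier) :
    topologicalEntropy Y.map ≤ topologicalEntropy X.map := by
  rw [topologicalEntropy_map, topologicalEntropy_map]
  exact Dynamics.coverEntropy_monotone shift h

/-- A subshift with a single point has no entropy. -/
theorem topologicalEntropy_le_zero_of_eq_singleton {X : Subshift} {x : Sigma2}
    (h : X.carrier = {x}) : topologicalEntropy X.map ≤ 0 := by
  have hx : shift x = x := by
    have := X.mapsTo (h ▸ Set.mem_singleton x : x ∈ X.carrier)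
    rwa [h] at this
  rw [topologicalEntropy_map, h]
  refine iSup₂_le fun U hU => ?_
  have hc : ∀ n, Dynamics.coverMincard shift {x} U n ≤ 1 := fun n => by
    have hcov : Dynamics.IsDynCoverOf shift {x} U n (({x} : Finset Sigma2) : Set Sigma2) := by
      rintro y rfl
      refine ⟨y, by simp, ?_⟩
      rw [Dynamics.mem_dynEntourage]
      exact fun k _ => refl_mem_uniformity hU
    simpa using hcov.coverMincard_le_card
  refine (ExpGrowth.expGrowthSup_monotone (b := fun _ => 1) fun n => ?_).trans
    (ExpGrowth.expGrowthSup_const one_ne_zero ENNReal.one_ne_top).le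
  simpa using ENat.toENNReal_mono (hc n)

/-- If, for infinitely many `n`, the subshift has at least `2 ^ (n / 2)` words of length `n`, then
its entropy is positive. The words are given by a set `s` of points with distinct prefixes. -/
theorem topologicalEntropy_pos (X : Subshift)
    (h : ∃ᶠ n : ℕ in Filter.atTop, ∃ s : Finset Sigma2, (s : Set Sigma2) ⊆ X.carrier ∧
      (∀ x ∈ s, ∀ y ∈ s, (∀ i < n, x i = y i) → x = y) ∧ 2 ^ n ≤ s.card ^ 2) :
    0 < topologicalEntropy X.map := by
  rw [topologicalEntropy_map]
  have hU : {p : Sigma2 × Sigma2 | dist p.1 p.2 < 1 / (((0 : ℕ) : ℝ) + 1)} ∈ uniformity Sigma2 :=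
    Metric.dist_mem_uniformity (by norm_num)
  refine lt_of_lt_of_le ?_ (Dynamics.netEntropyEntourage_le_coverEntropy shift X.carrier hU)
  have hlog : (0 : ℝ) < Real.log 2 / 2 := by positivity
  refine lt_of_lt_of_le (b := ((Real.log 2 / 2 : ℝ) : EReal)) (by exact_mod_cast hlog) ?_
  refine Frequently.le_expGrowthSup (h.mono ?_)
  rintro n ⟨s, hsX, hs, hcard⟩
  have hnet : Dynamics.IsDynNetIn shift X.carrier
      {p : Sigma2 × Sigma2 | dist p.1 p.2 < 1 / (((0 : ℕ) : ℝ) + 1)} n (s : Set Sigma2) := by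
    refine ⟨hsX, fun x hx y hy hxy => ?_⟩
    refine Set.disjoint_left.2 fun z hzx hzy => hxy (hs x hx y hy fun i hi => ?_)
    rw [Dynamics.mem_ball_dynEntourage] at hzx hzy
    have h1 := (dist_lt_iff _ _ 0).1 (hzx i hi) 0 le_rfl
    have h2 := (dist_lt_iff _ _ 0).1 (hzy i hi) 0 le_rfl
    simp only [iterate_shift_apply, add_zero] at h1 h2
    rw [← h1, ← h2]
  refine le_trans ?_ (ENat.toENNReal_mono hnet.card_le_netMaxcard)
  have he : Real.exp (Real.log 2 / 2 * n) ≤ s.card := by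
    have h2 : (2 : ℝ) ^ n ≤ (s.card : ℝ) ^ 2 := by exact_mod_cast hcard
    refine le_of_sq_le_sq ?_ (by positivity)
    rwa [← Real.exp_nat_mul, show ((2 : ℕ) : ℝ) * (Real.log 2 / 2 * n) = n * Real.log 2 by
      push_cast; ring, Real.exp_nat_mul, Real.exp_log two_pos]
  calc EReal.exp (((Real.log 2 / 2 : ℝ) : EReal) * (n : EReal))
      = EReal.exp ((Real.log 2 / 2 * n : ℝ) : EReal) := by
        rw [EReal.coe_mul]; rfl
    _ = ENNReal.ofReal (Real.exp (Real.log 2 / 2 * n)) := EReal.exp_coe _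
    _ ≤ ENNReal.ofReal s.card := ENNReal.ofReal_le_ofReal he
    _ = _ := by simp

/-! ### Conjugacy classes are countable -/

/-- A conjugacy onto a subshift is determined by the clopen set of points whose image starts with
`0`, and there are only countably many clopen sets. -/
theorem countable_setOf_areConjugate (X : Subshift) :
    {Y : Subshift | AreConjugate X.map Y.map}.Countable := by
  have hcomp := X.compactSpace_carrier
  have htd : TotallyDisconnectedSpace Sigma2 :=
    inferInstanceAs (TotallyDisconnectedSpace (ℕ → Fin 2))
  have hcount : Countable (TopologicalSpace.Clopens X.carrier) := by
    rw [TopologicalSpace.Clopens.countable_iff_secondCountable]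
    infer_instance
  have hcont : Continuous fun z : Sigma2 => z 0 := continuous_apply (A := fun _ : ℕ => Fin 2) 0
  choose φ hφ using fun Y : {Y : Subshift // AreConjugate X.map Y.map} => Y.2
  have hiter : ∀ Y x (n : ℕ), (φ Y x : Sigma2) n = (φ Y (X.map^[n] x) : Sigma2) 0 := by
    intro Y x n
    have : φ Y (X.map^[n] x) = Y.1.map^[n] (φ Y x) := (Function.Semiconj.iterate_right (hφ Y) n) x
    rw [this, coe_iterate_map, iterate_shift_apply, add_zero]
  let f : {Y : Subshift // AreConjugate X.map Y.map} → TopologicalSpace.Clopens X.carrier :=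
    fun Y => ⟨(fun x => (φ Y x : Sigma2) 0) ⁻¹' {0}, (isClopen_discrete _).preimage
      (hcont.comp (continuous_subtype_val.comp (φ Y).continuous))⟩
  have hf : Function.Injective f := by
    intro Y Z hYZ
    have h0 : ∀ x, (φ Y x : Sigma2) 0 = 0 ↔ (φ Z x : Sigma2) 0 = 0 := fun x =>
      Set.ext_iff.1 (congrArg (fun c : TopologicalSpace.Clopens X.carrier => (c : Set X.carrier))
        hYZ) x
    have hval : ∀ x, (φ Y x : Sigma2) = φ Z x := fun x => funext fun n => by
      rw [hiter Y x n, hiter Z x n]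
      have := h0 (X.map^[n] x)
      omega
    have hrange : ∀ W, W.1.carrier = Set.range fun x => (φ W x : Sigma2) := fun W => by
      ext w
      constructor
      · exact fun hw => ⟨(φ W).symm ⟨w, hw⟩, by simp⟩
      · rintro ⟨x, rfl⟩
        exact (φ W x).2
    refine Subtype.ext (ext_carrier ?_)
    exact (hrange Y).trans ((congrArg Set.range (funext hval)).trans (hrange Z).symm)
  exact hf.countable

end Subshift

/-! ### A minimal subshift of positive entropy -/

namespace Toeplitz

/-- The periods of the skeletons of the Toeplitz sequence `Toeplitz.seq`. -/
def period : ℕ → ℕ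
  | 0 => 1
  | k + 1 => period k * 2 ^ period k * 2 ^ (k + 2)

/-- At stage `k`, the holes in `[0, filled k)` are filled, with period `period (k + 1)`: this
interval consists of `2 ^ period k` blocks of length `period k`, one for each word. -/
def filled (k : ℕ) : ℕ := period k * 2 ^ period k

theorem period_succ (k : ℕ) : period (k + 1) = filled k * 2 ^ (k + 2) := rfl

theorem lt_period (k : ℕ) : k < period k := by
  induction k with
  | zero => exact Nat.one_pos
  | succ k ih =>
    have h1 : 1 ≤ 2 ^ period k := Nat.one_le_two_pow
    have h2 : 2 ≤ 2 ^ (k + 2) := Nat.le_self_pow (by omega) 2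
    calc k + 1 < (k + 1) * 1 * 2 := by omega
      _ ≤ period k * 2 ^ period k * 2 ^ (k + 2) := by gcongr; exact ih

theorem period_pos (k : ℕ) : 0 < period k := (Nat.zero_le k).trans_lt (lt_period k)

theorem period_le_filled (k : ℕ) : period k ≤ filled k :=
  Nat.le_mul_of_pos_right _ (by positivity)

theorem filled_le_period (k : ℕ) : filled k ≤ period (k + 1) :=
  Nat.le_mul_of_pos_right _ (by positivity)

theorem period_dvd {j k : ℕ} (h : j ≤ k) : period j ∣ period k := by
  induction h with
  | refl => rfl
  | step _ ih => exact ih.trans ((Dvd.intro _ rfl).trans (Dvd.intro _ rfl))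

theorem exists_mod_lt_filled (n : ℕ) : ∃ k, n % period (k + 1) < filled k :=
  ⟨n, (Nat.mod_le _ _).trans_lt ((lt_period n).trans_le (period_le_filled n))⟩

/-- The stage at which the position `n` is filled. -/
def stage (n : ℕ) : ℕ := Nat.find (exists_mod_lt_filled n)

theorem stage_eq {n k : ℕ} (h : n % period (k + 1) < filled k)
    (h' : ∀ j < k, filled j ≤ n % period (j + 1)) : stage n = k :=
  (Nat.find_eq_iff _).2 ⟨h, fun j hj => (h' j hj).not_gt⟩

/-- A Toeplitz sequence of positive entropy. At stage `k`, the holes in the `b`-th block of length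
`period k` in the interval `[0, filled k)` are filled with binary digits of `b`. -/
def seq : Sigma2 := fun n =>
  if ((n % period (stage n + 1)) / period (stage n)).testBit (n % period (stage n)) then 1 else 0

theorem seq_add_mul {m n : ℕ} (hn : n < m) (q : ℕ) : seq (n + period (m + 1) * q) = seq n := by
  have hmod : ∀ k ≤ m + 1, (n + period (m + 1) * q) % period k = n % period k := by
    intro k hk
    obtain ⟨c, hc⟩ := period_dvd hk
    rw [hc, mul_assoc, Nat.add_mul_mod_self_left]
  have hle : stage n ≤ m := Nat.find_min' _ <|
    (Nat.mod_le _ _).trans_lt (hn.trans ((lt_period m).trans_le (period_le_filled m)))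
  have hst : stage (n + period (m + 1) * q) = stage n := by
    refine stage_eq ?_ fun j hj => ?_
    · rw [hmod _ (by omega)]
      exact Nat.find_spec (exists_mod_lt_filled n)
    · rw [hmod _ (by omega)]
      exact not_lt.1 (Nat.find_min (exists_mod_lt_filled n) hj)
  simp only [seq, hst]
  rw [hmod _ (by omega), hmod _ (by omega)]

theorem uniformlyRecurrent_seq (m : ℕ) :
    ∃ P : ℕ, ∀ n : ℕ, ∃ i < P, ∀ j < m, seq (n + i + j) = seq j := by
  have hpos := period_pos (m + 1)
  refine ⟨period (m + 1), fun n => ?_⟩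
  -- the distance from `n` to the next multiple of the period
  refine ⟨(period (m + 1) - n % period (m + 1)) % period (m + 1), Nat.mod_lt _ hpos, ?_⟩
  intro j hj
  have hdvd : period (m + 1) ∣ n + (period (m + 1) - n % period (m + 1)) % period (m + 1) := by
    rw [Nat.dvd_iff_mod_eq_zero, Nat.add_mod_mod]
    have h1 := Nat.div_add_mod n (period (m + 1))
    have h2 := Nat.mod_lt n hpos
    have h3 : n + (period (m + 1) - n % period (m + 1)) =
        period (m + 1) * (n / period (m + 1) + 1) := by
      rw [mul_add]
      omega
    rw [h3, Nat.mul_mod_right]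
  obtain ⟨q, hq⟩ := hdvd
  rw [hq, add_comm, seq_add_mul hj]

/-- The positions in `[0, period k)` that are not filled before stage `k`. -/
def holes (k : ℕ) : Finset ℕ :=
  {i ∈ Finset.range (period k) | ∀ j < k, filled j ≤ i % period (j + 1)}

theorem card_filled_le {j k : ℕ} (h : j < k) :
    (({i ∈ Finset.range (period k) | i % period (j + 1) < filled j}.card : ℕ) : ℝ) ≤
      period k / 4 * (1 / 2) ^ j := by
  obtain ⟨q, hq⟩ := period_dvd (Nat.succ_le_of_lt h)
  have hcard : {i ∈ Finset.range (period k) | i % period (j + 1) < filled j}.card ≤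
      q * filled j := by
    refine le_of_le_of_eq (b := (Finset.range q ×ˢ Finset.range (filled j)).card) ?_ (by simp)
    refine Finset.card_le_card_of_injOn (fun i => (i / period (j + 1), i % period (j + 1))) ?_ ?_
    · intro i hi
      simp only [Finset.coe_filter, Finset.mem_range, Set.mem_ofPred_eq] at hi
      simp only [Finset.coe_product, Finset.coe_range, Set.mem_prod, Set.mem_Iio]
      exact ⟨Nat.div_lt_of_lt_mul (hq ▸ hi.1), hi.2⟩
    · intro a _ b _ hab
      simp only [Prod.mk.injEq] at hab
      rw [← Nat.div_add_mod a (period (j + 1)), hab.1, hab.2, Nat.div_add_mod]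
  have hP : (period k : ℝ) = filled j * 2 ^ (j + 2) * q := by
    rw [hq, Nat.succ_eq_add_one, period_succ]
    push_cast
    ring
  calc _ ≤ ((q * filled j : ℕ) : ℝ) := by exact_mod_cast hcard
    _ = period k / 4 * (1 / 2) ^ j := by
      rw [hP, one_div, inv_pow]
      push_cast
      field_simp
      ring

/-- At least half of all positions are holes. -/
theorem period_le_two_mul_card_holes (k : ℕ) : period k ≤ 2 * (holes k).card := by
  have hsub : Finset.range (period k) ⊆ holes k ∪ (Finset.range k).biUnion fun j =>
      {i ∈ Finset.range (period k) | i % period (j + 1) < filled j} := by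
    intro i hi
    by_cases h : ∀ j < k, filled j ≤ i % period (j + 1)
    · exact Finset.mem_union_left _ (Finset.mem_filter.2 ⟨hi, h⟩)
    · push Not at h
      obtain ⟨j, hj, hlt⟩ := h
      exact Finset.mem_union_right _ (Finset.mem_biUnion.2
        ⟨j, Finset.mem_range.2 hj, Finset.mem_filter.2 ⟨hi, hlt⟩⟩)
  have h1 := (Finset.card_le_card hsub).trans ((Finset.card_union_le _ _).trans
    (Nat.add_le_add_left Finset.card_biUnion_le _))
  rw [Finset.card_range] at h1
  have h2 : (period k : ℝ) ≤ (holes k).card + ∑ j ∈ Finset.range k,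
      (({i ∈ Finset.range (period k) | i % period (j + 1) < filled j}.card : ℕ) : ℝ) := by
    exact_mod_cast h1
  have h3 : ∑ j ∈ Finset.range k,
      (({i ∈ Finset.range (period k) | i % period (j + 1) < filled j}.card : ℕ) : ℝ) ≤
      period k / 4 * 2 := by
    refine (Finset.sum_le_sum fun j hj => card_filled_le (Finset.mem_range.1 hj)).trans ?_
    rw [← Finset.mul_sum]
    gcongr
    exact sum_geometric_two_le k
  have h4 : (period k : ℝ) ≤ 2 * (holes k).card := by linarith
  exact_mod_cast h4

theorem seq_block {k b i : ℕ} (hb : b < 2 ^ period k) (hi : i ∈ holes k) :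
    seq (b * period k + i) = if b.testBit i then 1 else 0 := by
  obtain ⟨hi1, hi2⟩ := Finset.mem_filter.1 hi
  rw [Finset.mem_range] at hi1
  have hlt : b * period k + i < filled k := by
    calc b * period k + i < (b + 1) * period k := by rw [add_mul]; omega
      _ ≤ 2 ^ period k * period k := Nat.mul_le_mul_right _ hb
      _ = filled k := mul_comm _ _
  have hmod : (b * period k + i) % period (k + 1) = b * period k + i :=
    Nat.mod_eq_of_lt (hlt.trans_le (filled_le_period k))
  have hst : stage (b * period k + i) = k := by
    refine stage_eq (by rwa [hmod]) fun j hj => ?_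
    obtain ⟨c, hc⟩ := period_dvd (Nat.succ_le_of_lt hj)
    rw [hc, Nat.succ_eq_add_one, mul_left_comm, Nat.mul_add_mod]
    exact hi2 j hj
  have hdiv : (b * period k + i) / period k = b := by
    rw [mul_comm, Nat.mul_add_div (period_pos k), Nat.div_eq_of_lt hi1, add_zero]
  have hmod' : (b * period k + i) % period k = i := by
    rw [mul_comm, Nat.mul_add_mod, Nat.mod_eq_of_lt hi1]
  simp only [seq, hst, hmod, hdiv, hmod']

theorem isMinimal : IsMinimal (Sigma2.orbitClosure seq).map :=
  Subshift.isMinimal_orbitClosure uniformlyRecurrent_seq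

theorem topologicalEntropy_pos : 0 < topologicalEntropy (Sigma2.orbitClosure seq).map := by
  classical
  refine Subshift.topologicalEntropy_pos _ (Filter.frequently_atTop.2 fun k => ?_)
  refine ⟨period k, (lt_period k).le, ?_⟩
  -- the blocks at stage `k` realise all possible fillings of the holes
  let f : Finset ℕ → Sigma2 := fun B =>
    Sigma2.shift^[Nat.ofBits (fun i : Fin (period k) => decide ((i : ℕ) ∈ B)) * period k] seq
  have hf : ∀ B, ∀ i ∈ holes k, f B i = 1 ↔ i ∈ B := by
    intro B i hi
    have hik : i < period k := Finset.mem_range.1 (Finset.mem_filter.1 hi).1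
    simp only [f, Sigma2.iterate_shift_apply]
    rw [seq_block (Nat.ofBits_lt_two_pow _) hi, Nat.testBit_ofBits_lt _ _ hik]
    simp
  have hinj : ∀ B ∈ (holes k).powerset, ∀ C ∈ (holes k).powerset,
      (∀ i < period k, f B i = f C i) → B = C := by
    intro B hB C hC h
    rw [Finset.mem_powerset] at hB hC
    ext i
    constructor
    · intro hi
      rw [← hf C i (hB hi), ← h i (Finset.mem_range.1 (Finset.mem_filter.1 (hB hi)).1)]
      exact (hf B i (hB hi)).2 hi
    · intro hi
      rw [← hf B i (hC hi), h i (Finset.mem_range.1 (Finset.mem_filter.1 (hC hi)).1)]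
      exact (hf C i (hC hi)).2 hi
  refine ⟨(holes k).powerset.image f, ?_, ?_, ?_⟩
  · intro x hx
    obtain ⟨B, _, rfl⟩ := Finset.mem_image.1 (Finset.mem_coe.1 hx)
    exact Sigma2.iterate_shift_mem_orbitClosure _ _
  · intro x hx y hy hxy
    obtain ⟨B, hB, rfl⟩ := Finset.mem_image.1 hx
    obtain ⟨C, hC, rfl⟩ := Finset.mem_image.1 hy
    rw [hinj B hB C hC hxy]
  · rw [Finset.card_image_of_injOn fun B hB C hC h => hinj B hB C hC fun i _ => by rw [h],
      Finset.card_powerset, ← pow_mul]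
    exact Nat.pow_le_pow_right two_pos (by linarith [period_le_two_mul_card_holes k])

end Toeplitz

/-! ### The hierarchical sequence -/

/-- `u` has a maximal run of exactly `r` zeros between the ones at `p` and `p + 1 + r`. -/
def IsRun (u : ℕ → Fin 2) (r p : ℕ) : Prop :=
  u p = 1 ∧ (∀ i < r, u (p + 1 + i) = 0) ∧ u (p + 1 + r) = 1

theorem IsRun.congr {u v : ℕ → Fin 2} {r p q : ℕ} (h : IsRun u r p)
    (huv : ∀ i ≤ r + 1, v (q + i) = u (p + i)) : IsRun v r q := by
  refine ⟨?_, fun i hi => ?_, ?_⟩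
  · exact (huv 0 (by omega)).trans h.1
  · rw [add_assoc, huv _ (by omega), ← add_assoc, h.2.1 i hi]
  · rw [add_assoc, huv _ (by omega), ← add_assoc, h.2.2]

/-- A run contains no one in its interior. -/
theorem IsRun.not_mem {u : ℕ → Fin 2} {r p q : ℕ} (h : IsRun u r p) (hp : p < q)
    (hq : q < p + 1 + r) : u q ≠ 1 := by
  have := h.2.1 (q - (p + 1)) (by omega)
  rw [show p + 1 + (q - (p + 1)) = q by omega] at this
  rw [this]
  exact zero_ne_one

/-- The data from which a hierarchical sequence is built: a sequence `y` starting with a one, in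
which each window of length `zeros` contains a one, and unbounded positions `cut k` of ones, at
which prefixes of `y` are cut off. -/
structure Seed where
  /-- the sequence whose prefixes are inserted -/
  y : Sigma2
  /-- a bound for the lengths of the runs of zeros of `y` -/
  zeros : ℕ
  /-- the position of the last symbol of the `k`-th inserted prefix of `y` -/
  cut : ℕ → ℕ
  y_zero : y 0 = 1
  exists_one : ∀ n, ∃ i < zeros, y (n + i) = 1
  le_cut : ∀ k, k ≤ cut k
  y_cut : ∀ k, y (cut k) = 1

namespace Seed

variable (S : Seed) (c : ℕ → Fin 2)

/-- The gap used at stage `k` if the current word has length `a`: it is long compared with that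
word and the inserted prefix, and its parity is the bit `c k`. -/
def gapOf (k a : ℕ) : ℕ := 2 * (S.zeros + 2 ^ k * (a + (S.cut k + 1))) + c k

/-- The length of the `k`-th word. -/
def len : ℕ → ℕ
  | 0 => 1
  | k + 1 => len k + S.gapOf c k (len k) + (S.cut k + 1) + S.gapOf c k (len k) + len k

/-- The length of the two blocks of zeros inserted at stage `k`. -/
def gap (k : ℕ) : ℕ := S.gapOf c k (S.len c k)

/-- The words of the hierarchical construction, extended by zeros. With `A k` the `k`-th word,
`W k` the prefix of `y` of length `cut k + 1` and `g = gap k`,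
`A 0 = 1` and `A (k + 1) = A k 0 ^ g W k 0 ^ g A k`. -/
def word : ℕ → ℕ → Fin 2
  | 0, n => if n = 0 then 1 else 0
  | k + 1, n =>
    if n < S.len c k + S.gap c k then word k n
    else if n < S.len c k + S.gap c k + (S.cut k + 1) then S.y (n - (S.len c k + S.gap c k))
    else if n < S.len c k + S.gap c k + (S.cut k + 1) + S.gap c k then 0
    else word k (n - (S.len c k + S.gap c k + (S.cut k + 1) + S.gap c k))

theorem len_succ (k : ℕ) : S.len c (k + 1) =
    S.len c k + S.gap c k + (S.cut k + 1) + S.gap c k + S.len c k := rfl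

theorem gap_eq (k : ℕ) :
    S.gap c k = 2 * (S.zeros + 2 ^ k * (S.len c k + (S.cut k + 1))) + c k := rfl

theorem zeros_lt_gap (k : ℕ) : S.zeros < S.gap c k := by
  have : 0 < 2 ^ k * (S.len c k + (S.cut k + 1)) := by positivity
  rw [gap_eq]
  omega

theorem mul_le_gap (k : ℕ) : 2 ^ k * (S.len c k + (S.cut k + 1)) ≤ S.gap c k := by
  rw [gap_eq]
  omega

theorem lt_len (k : ℕ) : k < S.len c k := by
  induction k with
  | zero => exact Nat.one_pos
  | succ k ih =>
    rw [len_succ]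
    omega

theorem len_mono : Monotone (S.len c) :=
  monotone_nat_of_le_succ fun k => by
    rw [len_succ]
    omega

theorem gap_strictMono : StrictMono (S.gap c) := by
  refine strictMono_nat_of_lt_succ fun k => ?_
  have h1 := S.mul_le_gap c (k + 1)
  have h2 : S.len c (k + 1) ≤ 2 ^ (k + 1) * (S.len c (k + 1) + (S.cut (k + 1) + 1)) :=
    (Nat.le_add_right _ _).trans (Nat.le_mul_of_pos_left _ (by positivity))
  have h3 := S.len_succ c k
  omega

theorem word_eq_zero {k n : ℕ} (h : S.len c k ≤ n) : S.word c k n = 0 := by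
  induction k generalizing n with
  | zero =>
    have : n ≠ 0 := by
      rintro rfl
      exact absurd h (S.lt_len c 0).not_ge
    simp [word, this]
  | succ k ih =>
    rw [len_succ] at h
    rw [word, if_neg (by omega), if_neg (by omega), if_neg (by omega)]
    exact ih (by omega)

theorem word_succ_of_lt {k n : ℕ} (h : n < S.len c k + S.gap c k) :
    S.word c (k + 1) n = S.word c k n := by
  rw [word, if_pos h]

theorem word_succ_prefix {k n : ℕ} (h : n ≤ S.cut k) :
    S.word c (k + 1) (S.len c k + S.gap c k + n) = S.y n := by
  rw [word, if_neg (by omega), if_pos (by omega)]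
  congr 1
  omega

theorem word_succ_gap {k n : ℕ} (h : S.len c k + S.gap c k + (S.cut k + 1) ≤ n)
    (h' : n < S.len c k + S.gap c k + (S.cut k + 1) + S.gap c k) : S.word c (k + 1) n = 0 := by
  rw [word, if_neg (by omega), if_neg (by omega), if_pos h']

theorem word_succ_copy (k n : ℕ) :
    S.word c (k + 1) (S.len c k + S.gap c k + (S.cut k + 1) + S.gap c k + n) = S.word c k n := by
  rw [word, if_neg (by omega), if_neg (by omega), if_neg (by omega)]
  congr 1
  omega

theorem word_zero (k : ℕ) : S.word c k 0 = 1 := by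
  induction k with
  | zero => simp [word]
  | succ k ih => rwa [word_succ_of_lt _ _ (by have := S.lt_len c k; omega)]

theorem word_last (k : ℕ) : S.word c k (S.len c k - 1) = 1 := by
  induction k with
  | zero => simp [word, len]
  | succ k ih =>
    have := S.lt_len c k
    rw [len_succ, Nat.add_sub_assoc (by omega), word_succ_copy, ih]

theorem word_eq_of_le {k K n : ℕ} (hk : k ≤ K) (h : n < S.len c k + S.gap c k) :
    S.word c K n = S.word c k n := by
  induction K, hk using Nat.le_induction with
  | base => rfl
  | succ K hk ih =>
    rw [word_succ_of_lt, ih]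
    rcases hk.eq_or_lt with rfl | hlt
    · exact h
    · have h1 := S.len_mono c (show k + 1 ≤ K from hlt)
      have h2 := S.len_succ c k
      omega

/-- The runs of the next word are those of the two copies of the previous word, the two gaps, and
the short runs of the inserted prefix of `y`. -/
theorem isRun_word_succ {k r p : ℕ} (h : IsRun (S.word c (k + 1)) r p) :
    (p < S.len c k ∧ IsRun (S.word c k) r p) ∨ r = S.gap c k ∨ r < S.zeros ∨
      ∃ q, p = S.len c k + S.gap c k + (S.cut k + 1) + S.gap c k + q ∧ IsRun (S.word c k) r q := by
  have hlen := S.lt_len c k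
  have hone : ∀ q, S.word c (k + 1) q = 1 → ¬ (S.len c k ≤ q ∧ q < S.len c k + S.gap c k) ∧
      ¬ (S.len c k + S.gap c k + (S.cut k + 1) ≤ q ∧
        q < S.len c k + S.gap c k + (S.cut k + 1) + S.gap c k) := by
    intro q hq
    constructor
    · rintro ⟨h1, h2⟩
      rw [word_succ_of_lt _ _ h2, word_eq_zero _ _ h1] at hq
      exact zero_ne_one hq
    · rintro ⟨h1, h2⟩
      rw [word_succ_gap _ _ h1 h2] at hq
      exact zero_ne_one hq
  have hp := hone p h.1
  have hq := hone _ h.2.2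
  rcases lt_or_ge p (S.len c k) with hpl | hpl
  · rcases lt_or_ge (p + 1 + r) (S.len c k) with hql | hql
    · refine Or.inl ⟨hpl, h.congr fun i hi => ?_⟩
      rw [word_succ_of_lt _ _ (by omega)]
    · -- the run starts with the last one of the first copy, and ends with the first one of `W k`
      have h1 : ¬ p < S.len c k - 1 := fun hlt => h.not_mem hlt (by omega) <| by
        rw [word_succ_of_lt _ _ (by omega), word_last]
      have h2 : ¬ S.len c k + S.gap c k < p + 1 + r := fun hlt =>
        h.not_mem (by omega) hlt (by simpa [S.y_zero] using S.word_succ_prefix c (Nat.zero_le _))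
      exact Or.inr (Or.inl (by omega))
  have hpl' : S.len c k + S.gap c k ≤ p := by omega
  rcases lt_or_ge p (S.len c k + S.gap c k + (S.cut k + 1)) with hpw | hpw
  · obtain ⟨q, rfl⟩ := Nat.exists_eq_add_of_le hpl'
    rcases lt_or_ge (S.len c k + S.gap c k + q + 1 + r) (S.len c k + S.gap c k + (S.cut k + 1))
      with hqw | hqw
    · refine Or.inr (Or.inr (Or.inl ?_))
      by_contra hr
      obtain ⟨i, hi, hy⟩ := S.exists_one (q + 1)
      refine h.not_mem (q := S.len c k + S.gap c k + (q + 1 + i)) (by omega) (by omega) ?_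
      rw [word_succ_prefix _ _ (by omega), hy]
    · -- the run starts with the last one of `W k`, and ends with the first one of the second copy
      have h1 : ¬ q < S.cut k := fun hlt =>
        h.not_mem (q := S.len c k + S.gap c k + S.cut k) (by omega) (by omega) <| by
          rw [word_succ_prefix _ _ le_rfl, S.y_cut]
      have h2 : ¬ S.len c k + S.gap c k + (S.cut k + 1) + S.gap c k <
          S.len c k + S.gap c k + q + 1 + r := fun hlt =>
        h.not_mem (by omega) hlt (by simpa [word_zero] using S.word_succ_copy c k 0)
      exact Or.inr (Or.inl (by omega))
  · have hpw' : S.len c k + S.gap c k + (S.cut k + 1) + S.gap c k ≤ p := by omega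
    obtain ⟨q, rfl⟩ := Nat.exists_eq_add_of_le hpw'
    refine Or.inr (Or.inr (Or.inr ⟨q, rfl, h.congr fun i hi => ?_⟩))
    rw [add_assoc _ q i, word_succ_copy]

theorem isRun_word {k r p : ℕ} (h : IsRun (S.word c k) r p) :
    r < S.zeros ∨ ∃ j < k, r = S.gap c j := by
  induction k generalizing p with
  | zero =>
    exact absurd h.2.2 (by simp [word])
  | succ k ih =>
    rcases S.isRun_word_succ c h with ⟨_, h'⟩ | h' | h' | ⟨q, _, h'⟩
    · exact (ih h').imp_right fun ⟨j, hj, hr⟩ => ⟨j, hj.trans k.lt_succ_self, hr⟩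
    · exact Or.inr ⟨k, k.lt_succ_self, h'⟩
    · exact Or.inl h'
    · exact (ih h').imp_right fun ⟨j, hj, hr⟩ => ⟨j, hj.trans k.lt_succ_self, hr⟩

theorem isRun_gap_word {k K : ℕ} (hk : k < K) :
    IsRun (S.word c K) (S.gap c k) (S.len c k - 1) := by
  have hlen := S.lt_len c k
  have hlt : ∀ n < S.len c k + S.gap c k + (S.cut k + 1),
      S.word c K n = S.word c (k + 1) n := fun n hn =>
    S.word_eq_of_le c hk (by rw [len_succ]; omega)
  refine ⟨?_, fun i hi => ?_, ?_⟩
  · rw [hlt _ (by omega), word_succ_of_lt _ _ (by omega), word_last]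
  · rw [hlt _ (by omega), word_succ_of_lt _ _ (by omega), word_eq_zero _ _ (by omega)]
  · rw [hlt _ (by omega), show S.len c k - 1 + 1 + S.gap c k = S.len c k + S.gap c k + 0 by omega,
      word_succ_prefix _ _ (Nat.zero_le _), S.y_zero]

/-- The number of ones that an interval contributes to a window is at most its length. -/
theorem sum_indicator_le (p n a l : ℕ) :
    ∑ i ∈ Finset.range n, (if a ≤ p + i ∧ p + i < a + l then 1 else 0) ≤ l := by
  rw [Finset.sum_boole, Nat.cast_id]
  calc _ ≤ (Finset.Ico a (a + l)).card :=
        Finset.card_le_card_of_injOn (fun i => p + i) (fun i hi => by simp_all)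
          (fun i _ j _ hij => Nat.add_left_cancel hij)
    _ = l := by simp

/-- After a run of length `gap k`, which shows that the `k + 1`-st word has just been read,
the frequency of ones is at most `2 ^ (-k)` up to a bounded error. -/
theorem sum_word_le {k K p : ℕ} (hk : k < K) (h : IsRun (S.word c K) (S.gap c k) p) (n : ℕ) :
    2 ^ k * ∑ i ∈ Finset.range n, (S.word c K (p + i) : ℕ) ≤ 2 ^ k * S.len c (k + 1) + n := by
  induction K, (show k + 1 ≤ K from hk) using Nat.le_induction generalizing p n with
  | base =>
    refine (Nat.mul_le_mul_left _ ?_).trans (Nat.le_add_right _ _)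
    refine (Finset.sum_le_sum fun i _ => ?_).trans (sum_indicator_le p n 0 (S.len c (k + 1)))
    split_ifs with hi
    · omega
    · rw [word_eq_zero _ _ (by omega)]
      rfl
  | succ K hK ih =>
    replace ih := fun {p : ℕ} => @ih p hK
    rcases S.isRun_word_succ c h with ⟨hp, h'⟩ | h' | h' | ⟨q, rfl, h'⟩
    · have hK' : k < K := hK
      -- a one lies in the first copy, or in the interval of `W K`, or in that of the second copy
      have hle : ∀ i, (S.word c (K + 1) (p + i) : ℕ) ≤ S.word c K (p + i) +
          (if S.len c K + S.gap c K ≤ p + i ∧ p + i < S.len c K + S.gap c K + (S.cut K + 1)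
            then 1 else 0) +
          (if S.len c K + S.gap c K + (S.cut K + 1) + S.gap c K ≤ p + i ∧
            p + i < S.len c K + S.gap c K + (S.cut K + 1) + S.gap c K + S.len c K
            then 1 else 0) := by
        intro i
        rcases lt_or_ge (p + i) (S.len c K + S.gap c K) with h1 | h1
        · rw [word_succ_of_lt _ _ h1]
          omega
        rcases lt_or_ge (p + i) (S.len c K + S.gap c K + (S.cut K + 1)) with h2 | h2
        · rw [if_pos ⟨h1, h2⟩]
          omega
        rcases lt_or_ge (p + i) (S.len c K + S.gap c K + (S.cut K + 1) + S.gap c K) with h3 | h3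
        · rw [word_succ_gap _ _ h2 h3]
          exact Nat.zero_le _
        rcases lt_or_ge (p + i)
          (S.len c K + S.gap c K + (S.cut K + 1) + S.gap c K + S.len c K) with h4 | h4
        · rw [if_neg (by omega), if_pos ⟨h3, h4⟩]
          omega
        · rw [word_eq_zero _ _ (by rw [len_succ]; omega)]
          exact Nat.zero_le _
      rcases le_or_gt (p + n) (S.len c K + S.gap c K) with hn | hn
      · refine le_trans (Nat.mul_le_mul_left _ (Finset.sum_le_sum fun i hi => ?_)) (ih h' n)
        rw [Finset.mem_range] at hi
        rw [word_succ_of_lt _ _ (by omega)]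
      · -- beyond the first gap, the ones of `W K` and the second copy are paid for by that gap
        have h1 : ∑ i ∈ Finset.range n, (S.word c K (p + i) : ℕ) =
            ∑ i ∈ Finset.range (S.len c K - p), (S.word c K (p + i) : ℕ) := by
          refine (Finset.sum_subset (Finset.range_subset_range.2 (by omega)) fun i _ hi => ?_).symm
          rw [Finset.mem_range] at hi
          rw [word_eq_zero _ _ (by omega)]
          rfl
        have h2 := ih h' (S.len c K - p)
        have h3 : ∑ i ∈ Finset.range n, (S.word c (K + 1) (p + i) : ℕ) ≤
            ∑ i ∈ Finset.range (S.len c K - p), (S.word c K (p + i) : ℕ) +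
              (S.cut K + 1) + S.len c K := by
          refine (Finset.sum_le_sum fun i _ => hle i).trans ?_
          rw [Finset.sum_add_distrib, Finset.sum_add_distrib, h1]
          exact add_le_add (add_le_add le_rfl (sum_indicator_le _ _ _ _)) (sum_indicator_le _ _ _ _)
        have h4 : 2 ^ k * (S.len c K + (S.cut K + 1)) ≤ S.gap c K :=
          (Nat.mul_le_mul_right _ (Nat.pow_le_pow_right two_pos hK'.le)).trans (S.mul_le_gap c K)
        have h5 := Nat.mul_le_mul_left (2 ^ k) h3
        have h6 : 2 ^ k * (∑ i ∈ Finset.range (S.len c K - p), (S.word c K (p + i) : ℕ) +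
              (S.cut K + 1) + S.len c K) =
            2 ^ k * ∑ i ∈ Finset.range (S.len c K - p), (S.word c K (p + i) : ℕ) +
              2 ^ k * (S.len c K + (S.cut K + 1)) := by ring
        omega
    · exact absurd h' (S.gap_strictMono c hK).ne
    · exact absurd h' (S.zeros_lt_gap c k).not_gt
    · simp only [add_assoc _ q, word_succ_copy]
      exact ih h' n

/-! ### The limit sequence -/

/-- The sequence that starts with all words of the construction. -/
def seq : Sigma2 := fun n => S.word c n n

theorem seq_eq {k n : ℕ} (h : n < S.len c k + S.gap c k) : S.seq c n = S.word c k n := by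
  rcases le_total k n with hkn | hkn
  · exact S.word_eq_of_le c hkn h
  · exact (S.word_eq_of_le c hkn (by have := S.lt_len c n; omega)).symm

theorem exists_isRun_word {r p : ℕ} (h : IsRun (S.seq c) r p) (n : ℕ) :
    ∃ K ≥ n, IsRun (S.word c K) r p ∧ p + n < S.len c K := by
  refine ⟨p + r + n + 2, by omega, h.congr fun i hi => ?_, ?_⟩
  · have := S.lt_len c (p + r + n + 2)
    rw [S.seq_eq c (k := p + r + n + 2) (by omega)]
  · have := S.lt_len c (p + r + n + 2)
    omega

theorem isRun_gap_seq (k : ℕ) : IsRun (S.seq c) (S.gap c k) (S.len c k - 1) := by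
  have hlen := S.lt_len c k
  refine (S.isRun_gap_word c k.lt_succ_self).congr fun i hi => ?_
  rw [S.seq_eq c (k := k + 1) (by rw [len_succ]; omega)]

theorem isRun_seq {r p : ℕ} (h : IsRun (S.seq c) r p) : r < S.zeros ∨ ∃ j, r = S.gap c j := by
  obtain ⟨K, _, h', _⟩ := S.exists_isRun_word c h 0
  exact (S.isRun_word c h').imp_right fun ⟨j, _, hj⟩ => ⟨j, hj⟩

theorem sum_seq_le {k p : ℕ} (h : IsRun (S.seq c) (S.gap c k) p) (n : ℕ) :
    2 ^ k * ∑ i ∈ Finset.range n, (S.seq c (p + i) : ℕ) ≤ 2 ^ k * S.len c (k + 1) + n := by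
  obtain ⟨K, hK, h', hlt⟩ := S.exists_isRun_word c h (n + k + 1)
  rw [Finset.sum_congr rfl fun i hi => by
    rw [S.seq_eq c (k := K) (by rw [Finset.mem_range] at hi; omega)]]
  exact S.sum_word_le c (by omega) h' n

/-- The subshift generated by the hierarchical sequence. -/
def subshift : Subshift := Sigma2.orbitClosure (S.seq c)

/-- Points close to `seq` have few ones, too. -/
theorem sum_le_of_mem {k : ℕ} {z : Sigma2} (hz : z ∈ (S.subshift c).carrier)
    (h : ∀ i ≤ S.len c k + S.gap c k, z i = S.seq c i) (n : ℕ) :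
    2 ^ k * ∑ i ∈ Finset.range n, (z (S.len c k - 1 + i) : ℕ) ≤
      2 ^ k * S.len c (k + 1) + n := by
  have hlen := S.lt_len c k
  obtain ⟨q, hq⟩ := (Sigma2.mem_orbitClosure _ _).1 hz (S.len c k + S.gap c k + n + 1)
  have hrun : IsRun (S.seq c) (S.gap c k) (q + (S.len c k - 1)) :=
    (S.isRun_gap_seq c k).congr fun i hi => by
      rw [add_assoc, hq _ (by omega), h _ (by omega)]
  rw [Finset.sum_congr rfl fun i hi => by
    rw [← hq (S.len c k - 1 + i) (by rw [Finset.mem_range] at hi; omega), ← add_assoc]]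
  exact S.sum_seq_le c hrun n

theorem isTransitive : IsTransitive (S.subshift c).map := by
  refine ⟨⟨S.seq c, Sigma2.self_mem_orbitClosure _⟩, ?_⟩
  rw [Subshift.isTransitivePoint_iff]
  intro z hz m N
  obtain ⟨p, hp⟩ := (Sigma2.mem_orbitClosure _ _).1 hz m
  -- the word of `z` occurs in the word of stage `N + p + m`, hence in its second copy
  set k := N + p + m
  have hlen := S.lt_len c k
  refine ⟨S.len c k + S.gap c k + (S.cut k + 1) + S.gap c k + p, by omega, fun i hi => ?_⟩
  change S.seq c _ = _
  rw [← hp i hi, S.seq_eq c (k := k + 1) (by rw [len_succ]; omega), add_assoc _ p i,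
    word_succ_copy, S.seq_eq c (k := k) (by omega)]

theorem orbitClosure_y_subset : (Sigma2.orbitClosure S.y).carrier ⊆ (S.subshift c).carrier := by
  intro z hz
  rw [Sigma2.mem_orbitClosure] at hz
  refine (Sigma2.mem_orbitClosure _ _).2 fun m => ?_
  obtain ⟨p, hp⟩ := hz m
  have hcut := S.le_cut (p + m)
  refine ⟨S.len c (p + m) + S.gap c (p + m) + p, fun i hi => ?_⟩
  rw [← hp i hi, S.seq_eq c (k := p + m + 1) (by rw [len_succ]; omega), add_assoc _ p i,
    word_succ_prefix _ _ (by omega)]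

/-- The parameter `c` is recovered from the parities of the long runs of zeros. -/
theorem subshift_injective : Function.Injective S.subshift := by
  have hsub : ∀ c d, S.subshift c = S.subshift d →
      Set.range (S.gap c) ⊆ Set.range (S.gap d) := by
    rintro c d h _ ⟨k, rfl⟩
    have hc : S.seq c ∈ (S.subshift d).carrier := by
      rw [← h]
      exact Sigma2.self_mem_orbitClosure _
    have hlen := S.lt_len c k
    obtain ⟨q, hq⟩ := (Sigma2.mem_orbitClosure _ _).1 hc (S.len c k + S.gap c k + 1)
    have hrun : IsRun (S.seq d) (S.gap c k) (q + (S.len c k - 1)) :=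
      (S.isRun_gap_seq c k).congr fun i hi => by rw [add_assoc, hq _ (by omega)]
    rcases S.isRun_seq d hrun with hlt | ⟨j, hj⟩
    · exact absurd hlt (S.zeros_lt_gap c k).not_gt
    · exact ⟨j, hj.symm⟩
  intro c d h
  have hgap : S.gap c = S.gap d := ((S.gap_strictMono c).range_inj (S.gap_strictMono d)).1
    ((hsub c d h).antisymm (hsub d c h.symm))
  funext k
  have := congrFun hgap k
  rw [gap_eq, gap_eq] at this
  omega

end Seed

/-! ### Mean equicontinuity -/

namespace Sigma2

/-- Two points that show only zeros in a window are close. -/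
theorem dist_iterate_shift_le (u v : Sigma2) (L i : ℕ) :
    dist (shift^[i] u) (shift^[i] v) ≤ 1 / ((L : ℝ) + 1) +
      ∑ j ∈ Finset.range (L + 1), ((u (j + i) : ℕ) + (v (j + i) : ℕ) : ℝ) := by
  have hnonneg : ∀ j ∈ Finset.range (L + 1), (0 : ℝ) ≤ ((u (j + i) : ℕ) + (v (j + i) : ℕ) : ℝ) :=
    fun j _ => by positivity
  by_cases h : ∀ j ≤ L, u (j + i) = 0 ∧ v (j + i) = 0
  · refine le_add_of_le_of_nonneg (le_of_lt ?_) (Finset.sum_nonneg hnonneg)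
    refine (dist_lt_iff _ _ _).2 fun j hj => ?_
    rw [iterate_shift_apply, iterate_shift_apply, add_comm i j, (h j hj).1, (h j hj).2]
  · push Not at h
    obtain ⟨j, hj, huv⟩ := h
    have h1 : 1 ≤ (u (j + i) : ℕ) + (v (j + i) : ℕ) := by
      by_cases hu : u (j + i) = 0
      · have := huv hu
        omega
      · omega
    have h2 : (1 : ℝ) ≤ ((u (j + i) : ℕ) + (v (j + i) : ℕ) : ℝ) := by exact_mod_cast h1
    have h3 := Finset.single_le_sum hnonneg (Finset.mem_range.2 (Nat.lt_succ_of_le hj))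
    have h4 : (0 : ℝ) ≤ 1 / ((L : ℝ) + 1) := by positivity
    linarith [dist_le_one (shift^[i] u) (shift^[i] v)]

/-- If `u` and `v` have few ones, then their orbits are close on average. -/
theorem limsup_dist_le {u v : Sigma2} {q C k : ℕ} (L : ℕ) {η : ℝ} (hη : 0 < η)
    (hu : ∀ n, 2 ^ k * ∑ i ∈ Finset.range n, (u (q + i) : ℕ) ≤ C + n)
    (hv : ∀ n, 2 ^ k * ∑ i ∈ Finset.range n, (v (q + i) : ℕ) ≤ C + n) :
    Filter.limsup (fun n : ℕ => (1 / (n : ℝ)) *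
      ∑ i ∈ Finset.range n, dist (shift^[i] u) (shift^[i] v)) Filter.atTop ≤
      1 / ((L : ℝ) + 1) + 2 * (L + 1) / 2 ^ k + η := by
  have hsum : ∀ w : Sigma2, (∀ n, 2 ^ k * ∑ i ∈ Finset.range n, (w (q + i) : ℕ) ≤ C + n) →
      ∀ n, ∀ j ≤ L, ∑ i ∈ Finset.range n, ((w (j + i) : ℕ) : ℝ) ≤ q + (C + (L + n)) / 2 ^ k := by
    intro w hw n j hj
    have h1 : ∑ i ∈ Finset.range n, (w (j + i) : ℕ) ≤
        q + ∑ i ∈ Finset.range (L + n), (w (q + i) : ℕ) := by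
      calc ∑ i ∈ Finset.range n, (w (j + i) : ℕ)
          ≤ ∑ i ∈ Finset.range j, (w i : ℕ) + ∑ i ∈ Finset.range n, (w (j + i) : ℕ) :=
            Nat.le_add_left _ _
        _ = ∑ i ∈ Finset.range (j + n), (w i : ℕ) := (Finset.sum_range_add _ _ _).symm
        _ ≤ ∑ i ∈ Finset.range (q + (L + n)), (w i : ℕ) :=
            Finset.sum_le_sum_of_subset (Finset.range_subset_range.2 (by omega))
        _ = ∑ i ∈ Finset.range q, (w i : ℕ) + ∑ i ∈ Finset.range (L + n), (w (q + i) : ℕ) :=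
            Finset.sum_range_add _ _ _
        _ ≤ q + ∑ i ∈ Finset.range (L + n), (w (q + i) : ℕ) := by
            refine Nat.add_le_add_right ?_ _
            calc _ ≤ ∑ i ∈ Finset.range q, 1 := Finset.sum_le_sum fun i _ => by omega
              _ = q := by simp
    have h2 : (∑ i ∈ Finset.range (L + n), ((w (q + i) : ℕ) : ℝ)) ≤ (C + (L + n)) / 2 ^ k := by
      rw [le_div_iff₀' (by positivity)]
      exact_mod_cast hw (L + n)
    have h3 : ∑ i ∈ Finset.range n, ((w (j + i) : ℕ) : ℝ) ≤
        q + ∑ i ∈ Finset.range (L + n), ((w (q + i) : ℕ) : ℝ) := by exact_mod_cast h1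
    linarith
  have htend : Filter.Tendsto (fun n : ℕ => 2 * (L + 1) * (q + (C + L) / 2 ^ k) / (n : ℝ))
      Filter.atTop (nhds 0) := tendsto_const_div_atTop_nhds_zero_nat _
  refine Filter.limsup_le_of_le (Filter.isCoboundedUnder_le_of_le Filter.atTop (x := 0)
    fun n => by positivity) ?_
  filter_upwards [htend.eventually_lt_const hη, Filter.eventually_gt_atTop 0] with n hn hpos
  have hpos' : (0 : ℝ) < n := by exact_mod_cast hpos
  have hdist : ∑ i ∈ Finset.range n, dist (shift^[i] u) (shift^[i] v) ≤
      n * (1 / ((L : ℝ) + 1)) + (L + 1) * (2 * (q + (C + (L + n)) / 2 ^ k)) := by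
    refine (Finset.sum_le_sum fun i _ => dist_iterate_shift_le u v L i).trans ?_
    rw [Finset.sum_add_distrib, Finset.sum_comm]
    refine add_le_add (by simp) ?_
    calc _ ≤ ∑ j ∈ Finset.range (L + 1), (2 * (q + (C + (L + n)) / 2 ^ k) : ℝ) := by
          refine Finset.sum_le_sum fun j hj => ?_
          have hj' : j ≤ L := Nat.lt_succ_iff.1 (Finset.mem_range.1 hj)
          rw [Finset.sum_add_distrib, two_mul]
          exact add_le_add (hsum u hu n j hj') (hsum v hv n j hj')
      _ = _ := by simp
  calc (1 / (n : ℝ)) * ∑ i ∈ Finset.range n, dist (shift^[i] u) (shift^[i] v)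
      ≤ (1 / (n : ℝ)) *
        (n * (1 / ((L : ℝ) + 1)) + (L + 1) * (2 * (q + (C + (L + n)) / 2 ^ k))) := by gcongr
    _ = 1 / ((L : ℝ) + 1) + 2 * (L + 1) / 2 ^ k +
        2 * (L + 1) * (q + (C + L) / 2 ^ k) / (n : ℝ) := by
      field_simp
      ring
    _ ≤ _ := by linarith

end Sigma2

namespace Seed

variable (S : Seed) (c : ℕ → Fin 2)

theorem isMeanEquicontinuousPoint_seq :
    IsMeanEquicontinuousPoint (S.subshift c).map
      ⟨S.seq c, Sigma2.self_mem_orbitClosure _⟩ := by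
  intro ε hε
  obtain ⟨L, hL⟩ := exists_nat_one_div_lt (show 0 < ε / 4 by positivity)
  obtain ⟨k, hk⟩ := exists_pow_lt_of_lt_one (show 0 < ε / 4 / (2 * ((L : ℝ) + 1)) by positivity)
    (show (1 / 2 : ℝ) < 1 by norm_num)
  have hk' : 2 * ((L : ℝ) + 1) / 2 ^ k < ε / 4 := by
    rw [lt_div_iff₀ (by positivity), one_div, inv_pow] at hk
    rwa [div_eq_inv_mul]
  refine ⟨1 / (((S.len c k + S.gap c k : ℕ) : ℝ) + 1), by positivity, fun y hy => ?_⟩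
  rw [Subtype.dist_eq, Sigma2.dist_lt_iff] at hy
  have h := Sigma2.limsup_dist_le L (show 0 < ε / 4 by positivity)
    (S.sum_le_of_mem c (k := k) (Sigma2.self_mem_orbitClosure _) fun _ _ => rfl)
    (S.sum_le_of_mem c y.2 hy)
  simp only [Subtype.dist_eq, Subshift.coe_iterate_map]
  linarith

theorem isAlmostMeanEquicontinuous : IsAlmostMeanEquicontinuous (S.subshift c).map :=
  ⟨S.isTransitive c, _, S.isMeanEquicontinuousPoint_seq c⟩

end Seed

/-! ### Minimal subshifts of positive entropy as seeds -/

/-- A minimal subshift of positive entropy does not contain the fixed point `000⋯`, so the runs of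
zeros of its points have bounded length. -/
theorem exists_seed {Y : Subshift} (hmin : IsMinimal Y.map) (hent : 0 < topologicalEntropy Y.map) :
    ∃ S : Seed, Y.carrier ⊆ (Sigma2.orbitClosure S.y).carrier := by
  have hzero : (fun _ => 0 : Sigma2) ∉ Y.carrier := by
    intro h0
    refine hent.not_ge (Subshift.topologicalEntropy_le_zero_of_eq_singleton
      (x := (fun _ => 0 : Sigma2)) (Set.eq_singleton_iff_unique_mem.2 ⟨h0, fun z hz => ?_⟩))
    funext i
    obtain ⟨n, -, hn⟩ := (Y.isTransitivePoint_iff ⟨_, h0⟩).1 (hmin.2 _) z hz (i + 1) 0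
    exact (hn i i.lt_succ_self).symm
  obtain ⟨y, hy, hy0⟩ : ∃ y ∈ Y.carrier, y 0 = 1 := by
    obtain ⟨z, hz⟩ := Y.nonempty
    obtain ⟨p, hp⟩ : ∃ p, z p = 1 := by
      by_contra! h
      refine hzero ?_
      have : z = fun _ => 0 := funext fun p => by
        have := h p
        omega
      rwa [← this]
    exact ⟨Sigma2.shift^[p] z, Y.mapsTo.iterate p hz, by rwa [Sigma2.iterate_shift_apply]⟩
  obtain ⟨N, hN⟩ : ∃ N, ∀ n, ∃ i < N, y (n + i) = 1 := by
    by_contra! h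
    refine hzero (Y.isClosed.closure_subset_iff.2 (Set.Subset.refl _)
      ((Sigma2.mem_closure_iff_words _ _).2 fun m => ?_))
    obtain ⟨n, hn⟩ := h m
    refine ⟨Sigma2.shift^[n] y, Y.mapsTo.iterate n hy, fun i hi => ?_⟩
    have := hn i hi
    rw [Sigma2.iterate_shift_apply]
    omega
  choose i _ hi using fun n => hN n
  refine ⟨⟨y, N, fun k => k + i k, hy0, hN, fun k => Nat.le_add_right _ _, hi⟩, fun z hz => ?_⟩
  refine (Sigma2.mem_orbitClosure _ _).2 fun m => ?_
  obtain ⟨n, -, hn⟩ := (Y.isTransitivePoint_iff ⟨y, hy⟩).1 (hmin.2 _) z hz m 0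
  exact ⟨n, hn⟩

/-! ### Continuum many conjugacy classes -/

/-- Conjugacy of subshifts is an equivalence relation. -/
def conjugacySetoid : Setoid Subshift where
  r X Y := AreConjugate X.map Y.map
  iseqv :=
    { refl := fun _ => ⟨Homeomorph.refl _, fun _ => rfl⟩
      symm := by
        rintro X Y ⟨φ, hφ⟩
        refine ⟨φ.symm, fun y => φ.injective ?_⟩
        rw [hφ, φ.apply_symm_apply, φ.apply_symm_apply]
      trans := by
        rintro X Y Z ⟨φ, hφ⟩ ⟨ψ, hψ⟩
        refine ⟨φ.trans ψ, fun x => ?_⟩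
        change ψ (φ (X.map x)) = Z.map (ψ (φ x))
        rw [hφ, hψ] }

/-- Since conjugacy classes are countable, a family of distinct subshifts indexed by the Cantor
space contains continuum many pairwise non-conjugate ones. -/
theorem exists_pairwise_not_areConjugate {X : (ℕ → Fin 2) → Subshift}
    (hX : Function.Injective X) :
    ∃ c : ℝ → ℕ → Fin 2, Pairwise fun s t => ¬ AreConjugate (X (c s)).map (X (c t)).map := by
  let r : Setoid (ℕ → Fin 2) := conjugacySetoid.comap X
  have hcard : Cardinal.mk (ℕ → Fin 2) ≤ Cardinal.mk (Quotient r) := by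
    by_contra! hlt
    have hunc : Uncountable (ℕ → Fin 2) := by
      rw [← Cardinal.aleph0_lt_mk_iff]
      simpa using Cardinal.cantor Cardinal.aleph0
    obtain ⟨q, hq⟩ := Cardinal.exists_uncountable_fiber (Quotient.mk r) hlt
    obtain ⟨d, rfl⟩ := Quotient.exists_rep q
    refine not_countable_iff.2 hq (Set.Countable.to_subtype
      (((X d).countable_setOf_areConjugate.preimage hX).mono ?_))
    intro e he
    exact r.symm (Quotient.exact he)
  have hreal : Cardinal.mk ℝ ≤ Cardinal.mk (Quotient r) := by
    refine le_trans (le_of_eq ?_) hcard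
    rw [Cardinal.mk_real]
    simp
  obtain ⟨f⟩ := Cardinal.le_def _ _ |>.1 hreal
  refine ⟨fun t => (f t).out, fun s t hst hconj => hst (f.injective ?_)⟩
  rw [← Quotient.out_eq (f s), ← Quotient.out_eq (f t)]
  exact Quotient.sound hconj

end AlmostMeanEquicontinuity

open AlmostMeanEquicontinuity in
theorem corollary4p8 :
    (∀ Y : Subshift, IsMinimal Y.map → 0 < topologicalEntropy Y.map →
      ∃ X : Subshift, Y.carrier ⊆ X.carrier ∧
        IsAlmostMeanEquicontinuous X.map ∧ 0 < topologicalEntropy X.map) ∧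
    (∃ X : ℝ → Subshift,
      (∀ t : ℝ, IsAlmostMeanEquicontinuous (X t).map ∧ 0 < topologicalEntropy (X t).map ∧
        ∃ Y : Subshift, Y.carrier ⊆ (X t).carrier ∧
          IsMinimal Y.map ∧ 0 < topologicalEntropy Y.map) ∧
      Pairwise fun s t : ℝ => ¬ AreConjugate (X s).map (X t).map) := by
  constructor
  · intro Y hmin hent
    obtain ⟨S, hS⟩ := exists_seed hmin hent
    have hsub := hS.trans (S.orbitClosure_y_subset 0)
    exact ⟨S.subshift 0, hsub, S.isAlmostMeanEquicontinuous 0,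
      hent.trans_le (Subshift.topologicalEntropy_mono hsub)⟩
  · obtain ⟨S, hS⟩ := exists_seed Toeplitz.isMinimal Toeplitz.topologicalEntropy_pos
    obtain ⟨c, hc⟩ := exists_pairwise_not_areConjugate S.subshift_injective
    have hsub := fun t => hS.trans (S.orbitClosure_y_subset (c t))
    exact ⟨fun t => S.subshift (c t), fun t => ⟨S.isAlmostMeanEquicontinuous _,
      Toeplitz.topologicalEntropy_pos.trans_le (Subshift.topologicalEntropy_mono (hsub t)),
      _, hsub t, Toeplitz.isMinimal, Toeplitz.topologicalEntropy_pos⟩, hc⟩
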